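/- The Stone pairing $\langle\phi,G\rangle$ of a first-order formula $\phi(x_1,\dots,x_p)$ and a finite graph $G$ is the probability that $\phi$ is satisfied in $G$ by a $p$-tuple of vertices chosen uniformly at random from $V(G)^p$ (for a sentence $\phi$ it is $1$ if $G\models\phi$ and $0$ otherwise). A sequence $(G_n)$ of finite graphs is FO-convergent if $\langle\phi,G_n\rangle$ converges for every first-order formula $\phi$ in the language of graphs. For a vertex $r$ of $G$, the rooted graph $(G,r)$ is the structure obtained from $G$ by adding a constant symbol $\mathrm{Root}$ interpreted as $r$; Stone pairings and FO-convergence of sequences of rooted graphs are defined in the same way, using all first-order formulas in the language extended by $\mathrm{Root}$. Write $\xi(G)=\{v\in V(G): G\models\xi(v)\}$. **Proposition.** There exist an FO-convergent sequence $(G_n)$ of finite simple graphs and a first-order formula $\xi(x)$ in the language of graphs, with one free variable and with $G_n\models(\exists x)\,\xi(x)$ for all $n$, such that there is no choice of roots $r_n\in\xi(G_n)$ for which the sequence of rooted graphs $(G_n,r_n)$ is FO-convergent. -/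

import Mathlib

open FirstOrder

namespace StructuralConvergence

/-- The Stone pairing of a formula `φ` in `p` free variables and a finite structure `M`: the
probability that a uniformly random `p`-tuple of elements of `M` satisfies `φ`. For `p = 0` there
is exactly one (empty) tuple, so the value is `1` if `M ⊨ φ` and `0` otherwise. -/
noncomputable def stonePairing {L : Language} (M : Type) [L.Structure M] [Finite M] {p : ℕ}
    (φ : L.Formula (Fin p)) : ℝ :=
  (Nat.card {v : Fin p → M // φ.Realize v} : ℝ) / (Nat.card (Fin p → M) : ℝ)

/-- A sequence of finite `L`-structures is FO-convergent if the Stone pairings of every first-order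
formula (with any number `p ≥ 0` of free variables) converge. -/
def FOConvergent (L : Language) (M : ℕ → Type) [∀ n, L.Structure (M n)] [∀ n, Finite (M n)] :
    Prop :=
  ∀ (p : ℕ) (φ : L.Formula (Fin p)),
    ∃ a : ℝ, Filter.Tendsto (fun n => stonePairing (M n) φ) Filter.atTop (nhds a)

/-- The language of rooted graphs: the language of graphs with one additional constant symbol. -/
abbrev rootedGraphLanguage : Language := Language.graph[[Unit]]

/-- The rooted graph `(G, r)` as a structure in the language of rooted graphs: the additional
constant is interpreted as `r`. -/
@[reducible]
def rootedStructure {V : Type} (G : SimpleGraph V) (r : V) : rootedGraphLanguage.Structure V :=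
  letI := G.structure
  letI := Language.constantsOn.structure (fun _ : Unit => r)
  Language.withConstantsStructure Language.graph Unit

/-- FO-convergence of a sequence of finite graphs. -/
def GraphFOConvergent {V : ℕ → Type} [∀ n, Finite (V n)] (G : ∀ n, SimpleGraph (V n)) : Prop :=
  letI := fun n => (G n).structure
  FOConvergent Language.graph V

/-- FO-convergence of a sequence of finite rooted graphs `(G n, r n)`. -/
def RootedGraphFOConvergent {V : ℕ → Type} [∀ n, Finite (V n)] (G : ∀ n, SimpleGraph (V n))
    (r : ∀ n, V n) : Prop :=
  letI := fun n => rootedStructure (G n) (r n)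
  FOConvergent rootedGraphLanguage V

/-- The set of solutions `ξ(G)` in the graph `G` of a formula `ξ(x)` in one free variable. -/
def solutions {V : Type} (G : SimpleGraph V) (ξ : Language.graph.Formula (Fin 1)) : Set V :=
  letI := G.structure
  {v | ξ.Realize (fun _ => v)}

end StructuralConvergence

/-!
The `n`-th graph is a split graph: its vertices are a clique `A`, namely an `m × m` square with
`m = n + 1`, and an independent set `B` of all functions `b : A → Fin 5`. A vertex `a ∈ A` is
adjacent to `b ∈ B` when `b a < c`, where `c` is `2` for even `n` and `3` for odd `n`. The clique is
definable as the set of vertices with two distinct nonadjacent neighbours. It has vanishing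
proportion, and each of its vertices is adjacent to a fraction `c / 5` of `B`, so the density of the
neighbourhood of a root in the clique oscillates between values near `2 / 5` and `3 / 5`; hence no
sequence of roots in the clique is FO-convergent (`not_rootedGraphFOConvergent`).

Without a root, first-order logic does not see the value of `c`. Every subset of `A` is the
neighbourhood of many vertices of `B`, and the truth value of a formula at a tuple of vertices
depends only on the sides and the equalities of its entries and on the sizes, capped at some
threshold `T`, of the atoms into which the neighbourhoods split `A`. This is a back-and-forth
argument: one more quantifier splits each atom into two parts, which can be copied up to `T` if the
sizes of the atoms agree up to `2 * T` (`exists_subset_ncard_inter_diff`, `exists_threshold`). For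
almost all tuples all entries lie in `B` and all atoms are large (`le_card_isGeneric`), and any two
such tuples agree on a given formula, even if they come from graphs with different `c`. So all Stone
pairings tend to `0` or `1` (`graphFOConvergent_splitGraph`).
-/

namespace StructuralConvergence

open Language Filter Topology

/-! ### Split graphs and the traces of their vertices -/

/-- The split graph on `A ⊕ B` given by `E : A → B → Prop`: the part `A` is a clique, the part `B`
is independent, and `a ∈ A` is adjacent to `b ∈ B` if and only if `E a b`. -/
def splitGraph {A B : Type} (E : A → B → Prop) : SimpleGraph (A ⊕ B) where
  Adj
    | .inl a, .inl a' => a ≠ a'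
    | .inl a, .inr b => E a b
    | .inr b, .inl a => E a b
    | .inr _, .inr _ => False
  symm := ⟨by rintro (a | b) (a' | b') <;> simp [eq_comm]⟩
  loopless := ⟨by rintro (a | b) <;> simp⟩

/-- The trace on the clique `A` of a vertex of a split graph: `{a}` for a vertex `a ∈ A`, and the
neighbourhood of `b` for a vertex `b ∈ B`. -/
def trace {A B : Type} (E : A → B → Prop) : A ⊕ B → Set A
  | .inl a => {a}
  | .inr b => {a | E a b}

lemma splitGraph_adj_iff {A B : Type} {E : A → B → Prop} {x y : A ⊕ B} :
    (splitGraph E).Adj x y ↔ x ≠ y ∧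
      ((x.isLeft ∧ y.isLeft) ∨
        ((x.isLeft ∨ y.isLeft) ∧ ∃ a, a ∈ trace E x ∧ a ∈ trace E y)) := by
  rcases x with a | b <;> rcases y with a' | b' <;> simp [splitGraph, trace]

/-- The atom, with sign pattern `ε`, of the Boolean algebra of subsets of `A` generated by the
traces of a tuple `w` of vertices. -/
def cell {A B ι : Type} (E : A → B → Prop) (w : ι → A ⊕ B) (ε : ι → Prop) : Set A :=
  {a | ∀ i, a ∈ trace E (w i) ↔ ε i}

/-- Tuples of vertices of two split graphs are `T`-similar if they have the same equalities, their
entries lie on the same sides, and corresponding cells have the same size, where all sizes from `T`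
on are identified. -/
structure Similar {A B A' B' ι : Type} (T : ℕ) (E : A → B → Prop) (E' : A' → B' → Prop)
    (w : ι → A ⊕ B) (w' : ι → A' ⊕ B') : Prop where
  isLeft_eq : ∀ i, (w i).isLeft = (w' i).isLeft
  eq_iff : ∀ i j, w i = w j ↔ w' i = w' j
  ncard_cell : ∀ ε, min T (cell E w ε).ncard = min T (cell E' w' ε).ncard

/-- A split graph is `K`-rich if every subset of the clique is the neighbourhood of more than `K`
independent vertices. -/
def IsRich {A B : Type} (K : ℕ) (E : A → B → Prop) : Prop :=
  ∀ (S : Set A) (F : Finset B), F.card ≤ K → ∃ b ∉ F, ∀ a, E a b ↔ a ∈ S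

lemma IsRich.mono {A B : Type} {K L : ℕ} {E : A → B → Prop} (h : IsRich L E) (hKL : K ≤ L) :
    IsRich K E := fun S F hF => h S F (hF.trans hKL)

lemma min_eq_min_of_le {S T m n : ℕ} (hST : S ≤ T) (h : min T m = min T n) :
    min S m = min S n := by omega

namespace Similar

variable {A B A' B' ι : Type} {S T : ℕ} {E : A → B → Prop} {E' : A' → B' → Prop}
  {w : ι → A ⊕ B} {w' : ι → A' ⊕ B'}

lemma symm (h : Similar T E E' w w') : Similar T E' E w' w :=
  ⟨fun i => (h.isLeft_eq i).symm, fun i j => (h.eq_iff i j).symm, fun ε => (h.ncard_cell ε).symm⟩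

lemma mono (h : Similar T E E' w w') (hST : S ≤ T) : Similar S E E' w w' :=
  ⟨h.isLeft_eq, h.eq_iff, fun ε => min_eq_min_of_le hST (h.ncard_cell ε)⟩

lemma cell_nonempty [Finite A] [Finite A'] (h : Similar T E E' w w') (hT : 1 ≤ T) {ε : ι → Prop}
    (hε : (cell E w ε).Nonempty) : (cell E' w' ε).Nonempty := by
  have h1 := h.ncard_cell ε
  rw [← Set.ncard_pos] at hε ⊢
  omega

lemma exists_mem_trace [Finite A] [Finite A'] (h : Similar T E E' w w') (hT : 1 ≤ T) {i j : ι}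
    (hij : ∃ a, a ∈ trace E (w i) ∧ a ∈ trace E (w j)) :
    ∃ a, a ∈ trace E' (w' i) ∧ a ∈ trace E' (w' j) := by
  obtain ⟨a, hi, hj⟩ := hij
  obtain ⟨a', ha'⟩ := h.cell_nonempty hT (ε := fun k => a ∈ trace E (w k)) ⟨a, fun _ => Iff.rfl⟩
  exact ⟨a', (ha' i).2 hi, (ha' j).2 hj⟩

lemma adj_iff [Finite A] [Finite A'] (h : Similar T E E' w w') (hT : 1 ≤ T) (i j : ι) :
    (splitGraph E).Adj (w i) (w j) ↔ (splitGraph E').Adj (w' i) (w' j) := by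
  have h1 : (∃ a, a ∈ trace E (w i) ∧ a ∈ trace E (w j)) ↔
      ∃ a, a ∈ trace E' (w' i) ∧ a ∈ trace E' (w' j) :=
    ⟨h.exists_mem_trace hT, h.symm.exists_mem_trace hT⟩
  rw [splitGraph_adj_iff, splitGraph_adj_iff, h1, h.isLeft_eq, h.isLeft_eq, Ne, Ne, h.eq_iff]

end Similar

/-! ### The back-and-forth property -/

/-- If two finite sets have the same size up to threshold `2 * T`, then any splitting of the first
into two parts is matched, up to threshold `T`, by a splitting of the second. -/
lemma exists_subset_ncard_inter_diff {A A' : Type} [Finite A] [Finite A'] {T : ℕ} {C : Set A}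
    {C' : Set A'} (h : min (2 * T) C.ncard = min (2 * T) C'.ncard) (S : Set A) :
    ∃ S' ⊆ C', min T (C ∩ S).ncard = min T S'.ncard ∧
      min T (C \ S).ncard = min T (C' \ S').ncard := by
  have hs := Set.ncard_inter_add_ncard_sdiff_eq_ncard C S
  obtain ⟨k, hk, h1, h2⟩ : ∃ k ≤ C'.ncard, min T (C ∩ S).ncard = min T k ∧
      min T (C \ S).ncard = min T (C'.ncard - k) := by
    rcases lt_or_ge (C ∩ S).ncard T with h1 | h1
    · exact ⟨(C ∩ S).ncard, by omega, by omega, by omega⟩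
    · rcases lt_or_ge (C \ S).ncard T with h2 | h2
      · exact ⟨C'.ncard - (C \ S).ncard, by omega, by omega, by omega⟩
      · exact ⟨T, by omega, by omega, by omega⟩
  obtain ⟨S', hS', hc⟩ := Set.exists_subset_card_eq hk
  refine ⟨S', hS', by rw [hc, h1], ?_⟩
  rw [Set.ncard_sdiff hS', hc, h2]

section Extension

variable {A B A' B' ι : Type} {T : ℕ} {E : A → B → Prop} {E' : A' → B' → Prop}
  {w : ι → A ⊕ B} {w' : ι → A' ⊕ B'}

/-- `IsExtension T E E' w w' x x'` says that appending `x` to `w` and `x'` to `w'` yields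
`T`-similar tuples, provided that `w` and `w'` are similar. -/
structure IsExtension (T : ℕ) (E : A → B → Prop) (E' : A' → B' → Prop)
    (w : ι → A ⊕ B) (w' : ι → A' ⊕ B') (x : A ⊕ B) (x' : A' ⊕ B') : Prop where
  isLeft_eq : x.isLeft = x'.isLeft
  eq_iff : ∀ i, x = w i ↔ x' = w' i
  ncard_inter : ∀ ε, min T (cell E w ε ∩ trace E x).ncard = min T (cell E' w' ε ∩ trace E' x').ncard
  ncard_diff : ∀ ε, min T (cell E w ε \ trace E x).ncard = min T (cell E' w' ε \ trace E' x').ncard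

lemma cell_inter_trace (i : ι) (ε : ι → Prop) [Decidable (ε i)] :
    cell E w ε ∩ trace E (w i) = if ε i then cell E w ε else ∅ := by
  split_ifs with h
  · exact Set.inter_eq_left.2 fun a ha => (ha i).2 h
  · exact Set.eq_empty_of_forall_notMem fun a ha => h ((ha.1 i).1 ha.2)

lemma cell_diff_trace (i : ι) (ε : ι → Prop) [Decidable (ε i)] :
    cell E w ε \ trace E (w i) = if ε i then ∅ else cell E w ε := by
  split_ifs with h
  · exact Set.eq_empty_of_forall_notMem fun a ha => ha.2 ((ha.1 i).2 h)
  · exact sdiff_eq_left.2 (Set.disjoint_left.2 fun a ha hi => h ((ha i).1 hi))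

lemma Similar.isExtension_self (h : Similar (2 * T) E E' w w') (i : ι) :
    IsExtension T E E' w w' (w i) (w' i) := by
  classical
  refine ⟨h.isLeft_eq i, h.eq_iff i, fun ε => ?_, fun ε => ?_⟩
  · rw [cell_inter_trace, cell_inter_trace]
    split_ifs
    · exact min_eq_min_of_le (by omega) (h.ncard_cell ε)
    · simp
  · rw [cell_diff_trace, cell_diff_trace]
    split_ifs
    · simp
    · exact min_eq_min_of_le (by omega) (h.ncard_cell ε)

lemma mem_cell_iff {a : A} {ε : ι → Prop} : a ∈ cell E w ε ↔ (fun i => a ∈ trace E (w i)) = ε :=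
  ⟨fun h => funext fun i => propext (h i), fun h i => iff_of_eq (congrFun h i)⟩

/-- A clique vertex outside the tuple can be matched by any clique vertex in the same cell. -/
lemma Similar.exists_isExtension_inl [Finite A] [Finite A'] (hT : 1 ≤ T)
    (h : Similar (2 * T) E E' w w') {a : A} (ha : ∀ i, Sum.inl a ≠ w i) :
    ∃ x', IsExtension T E E' w w' (Sum.inl a) x' := by
  obtain ⟨a', ha'⟩ := h.cell_nonempty (by omega) (ε := fun k => a ∈ trace E (w k))
    ⟨a, fun _ => Iff.rfl⟩
  have hmem : ∀ ε, a ∈ cell E w ε ↔ a' ∈ cell E' w' ε := fun ε => by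
    rw [mem_cell_iff, mem_cell_iff, mem_cell_iff.1 ha']
  refine ⟨Sum.inl a', rfl, fun i => iff_of_false (ha i) fun hi => ?_, fun ε => ?_, fun ε => ?_⟩
  · have h1 : a ∈ trace E (w i) := (ha' i).1 (by rw [← hi]; rfl)
    have h2 := h.isLeft_eq i
    rw [← hi] at h2
    obtain ⟨c, hc⟩ := Sum.isLeft_iff.1 h2
    rw [hc] at h1
    exact ha i (by rw [hc, show a = c from h1])
  · by_cases hε : a ∈ cell E w ε
    · rw [trace, trace, Set.inter_singleton_of_mem hε, Set.inter_singleton_of_mem ((hmem ε).1 hε)]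
      simp
    · rw [trace, trace, Set.inter_singleton_of_notMem hε,
        Set.inter_singleton_of_notMem (mt (hmem ε).2 hε)]
      simp
  · have h1 := h.ncard_cell ε
    by_cases hε : a ∈ cell E w ε
    · rw [trace, trace, Set.ncard_sdiff_singleton_of_mem hε,
        Set.ncard_sdiff_singleton_of_mem ((hmem ε).1 hε)]
      omega
    · rw [trace, trace, Set.sdiff_singleton_eq_self hε,
        Set.sdiff_singleton_eq_self (mt (hmem ε).2 hε)]
      omega

/-- An independent vertex outside the tuple is matched by a fresh independent vertex whose
neighbourhood splits every cell in the same way. -/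
lemma Similar.exists_isExtension_inr [Finite A] [Finite A'] [Fintype ι]
    (h : Similar (2 * T) E E' w w') (hE' : IsRich (Fintype.card ι) E') {b : B}
    (hb : ∀ i, Sum.inr b ≠ w i) : ∃ x', IsExtension T E E' w w' (Sum.inr b) x' := by
  classical
  choose S' hS' hinter hdiff using fun ε =>
    exists_subset_ncard_inter_diff (h.ncard_cell ε) (trace E (Sum.inr b))
  obtain ⟨b', hb', hN⟩ := hE' {a' | a' ∈ S' fun i => a' ∈ trace E' (w' i)}
    (Finset.univ.image w').toRight
    ((Finset.card_toRight_le.trans Finset.card_image_le).trans_eq Finset.card_univ)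
  have htr : ∀ ε, cell E' w' ε ∩ trace E' (Sum.inr b') = S' ε := fun ε => by
    ext a'
    constructor
    · rintro ⟨h1, h2⟩
      have h3 := (hN a').1 h2
      rwa [Set.mem_ofPred_eq, mem_cell_iff.1 h1] at h3
    · intro h1
      refine ⟨hS' ε h1, (hN a').2 ?_⟩
      rwa [Set.mem_ofPred_eq, mem_cell_iff.1 (hS' ε h1)]
  refine ⟨Sum.inr b', rfl, fun i => iff_of_false (hb i) fun hi => hb' ?_, fun ε => ?_, fun ε => ?_⟩
  · simp only [Finset.mem_toRight, Finset.mem_image, Finset.mem_univ, true_and]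
    exact ⟨i, hi.symm⟩
  · rw [htr, hinter]
  · rw [← Set.sdiff_self_inter (s := cell E' w' ε), htr, hdiff]

lemma Similar.exists_isExtension [Finite A] [Finite A'] [Fintype ι] (hT : 1 ≤ T)
    (h : Similar (2 * T) E E' w w') (hE' : IsRich (Fintype.card ι) E') (x : A ⊕ B) :
    ∃ x', IsExtension T E E' w w' x x' := by
  by_cases hx : ∃ i, x = w i
  · obtain ⟨i, rfl⟩ := hx
    exact ⟨w' i, h.isExtension_self i⟩
  · push Not at hx
    rcases x with a | b
    · exact h.exists_isExtension_inl hT hx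
    · exact h.exists_isExtension_inr hE' hx

end Extension

section Snoc

variable {A B A' B' α : Type} {T n : ℕ} {E : A → B → Prop} {E' : A' → B' → Prop}

lemma cell_snoc (v : α → A ⊕ B) (xs : Fin n → A ⊕ B) (x : A ⊕ B)
    (ε : α ⊕ Fin (n + 1) → Prop) :
    cell E (Sum.elim v (Fin.snoc xs x)) ε =
      {a | a ∈ cell E (Sum.elim v xs)
          (Sum.elim (fun i => ε (.inl i)) fun i => ε (.inr i.castSucc)) ∧
        (a ∈ trace E x ↔ ε (.inr (Fin.last n)))} := by
  ext a
  simp [cell, Sum.forall, Fin.forall_fin_succ', and_assoc]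

lemma IsExtension.similar_snoc {v : α → A ⊕ B} {xs : Fin n → A ⊕ B} {x : A ⊕ B}
    {v' : α → A' ⊕ B'} {xs' : Fin n → A' ⊕ B'} {x' : A' ⊕ B'} {S : ℕ}
    (hx : IsExtension T E E' (Sum.elim v xs) (Sum.elim v' xs') x x')
    (h : Similar S E E' (Sum.elim v xs) (Sum.elim v' xs')) :
    Similar T E E' (Sum.elim v (Fin.snoc xs x)) (Sum.elim v' (Fin.snoc xs' x')) := by
  have hl := h.isLeft_eq
  have he := h.eq_iff
  have hxl := hx.isLeft_eq
  have hxe := hx.eq_iff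
  have hxe' : ∀ i, Sum.elim v xs i = x ↔ Sum.elim v' xs' i = x' := fun i => by
    rw [eq_comm, hxe, eq_comm]
  simp only [Sum.forall, Sum.elim_inl, Sum.elim_inr] at hl he hxe hxe'
  refine ⟨?_, ?_, fun ε => ?_⟩
  · simp [Sum.forall, Fin.forall_fin_succ', hl, hxl]
  · simp [Sum.forall, Fin.forall_fin_succ', he, hxe, hxe']
  · rw [cell_snoc, cell_snoc]
    by_cases hε : ε (.inr (Fin.last n))
    · simp only [hε, iff_true]
      exact hx.ncard_inter _
    · simp only [hε, iff_false]
      exact hx.ncard_diff _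

end Snoc

/-! ### First-order formulas do not distinguish similar tuples -/

/-- In the language of graphs every term is a variable. -/
lemma exists_realize_eq {β : Type} (t : Language.graph.Term β) :
    ∃ i, ∀ (V : Type) [Language.graph.Structure V] (v : β → V), t.realize v = v i := by
  cases t with
  | var i => exact ⟨i, fun _ _ _ => rfl⟩
  | func f _ => exact isEmptyElim f

/-- For every formula there is a threshold `T` such that `T`-similar tuples in `T`-rich split graphs
give it the same truth value. Each quantifier doubles `T`, as it consumes one splitting of cells. -/
lemma exists_threshold {α : Type} [Fintype α] {n : ℕ} (φ : Language.graph.BoundedFormula α n) :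
    ∃ T, 1 ≤ T ∧ ∀ {A B A' B' : Type} [Finite A] [Finite A'] {E : A → B → Prop}
      {E' : A' → B' → Prop} {v : α → A ⊕ B} {xs : Fin n → A ⊕ B} {v' : α → A' ⊕ B'}
      {xs' : Fin n → A' ⊕ B'}, IsRich T E → IsRich T E' →
      Similar T E E' (Sum.elim v xs) (Sum.elim v' xs') →
      (@BoundedFormula.Realize _ _ (splitGraph E).structure _ _ φ v xs ↔
        @BoundedFormula.Realize _ _ (splitGraph E').structure _ _ φ v' xs') := by
  induction φ with
  | falsum => exact ⟨1, le_rfl, fun _ _ _ => Iff.rfl⟩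
  | equal t₁ t₂ =>
    obtain ⟨i, hi⟩ := exists_realize_eq t₁
    obtain ⟨j, hj⟩ := exists_realize_eq t₂
    refine ⟨1, le_rfl, fun {A B A' B'} _ _ {E E' v xs v' xs'} _ _ h => ?_⟩
    simp only [BoundedFormula.Realize, hi, hj]
    exact h.eq_iff i j
  | rel R ts =>
    cases R
    obtain ⟨i, hi⟩ := exists_realize_eq (ts 0)
    obtain ⟨j, hj⟩ := exists_realize_eq (ts 1)
    refine ⟨1, le_rfl, fun {A B A' B'} _ _ {E E' v xs v' xs'} _ _ h => ?_⟩
    simp only [BoundedFormula.Realize, Structure.RelMap, hi, hj]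
    exact h.adj_iff le_rfl i j
  | imp f₁ f₂ ih₁ ih₂ =>
    obtain ⟨T₁, h₁, H₁⟩ := ih₁
    obtain ⟨T₂, h₂, H₂⟩ := ih₂
    refine ⟨max T₁ T₂, by omega, fun {A B A' B'} _ _ {E E' v xs v' xs'} hE hE' h => ?_⟩
    exact imp_congr
      (H₁ (hE.mono (le_max_left _ _)) (hE'.mono (le_max_left _ _)) (h.mono (le_max_left _ _)))
      (H₂ (hE.mono (le_max_right _ _)) (hE'.mono (le_max_right _ _)) (h.mono (le_max_right _ _)))
  | @all n f ih =>
    obtain ⟨T, hT, H⟩ := ih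
    -- The second term of the maximum leaves room for a vertex outside the current tuple.
    set K := max (2 * T) (Fintype.card (α ⊕ Fin n)) with hK
    refine ⟨K, by omega, fun {A B A' B'} _ _ {E E' v xs v' xs'} hE hE' h => ?_⟩
    have h2 := h.mono (le_max_left (2 * T) (Fintype.card (α ⊕ Fin n)))
    constructor
    · intro hf x'
      obtain ⟨x, hx⟩ := h2.symm.exists_isExtension hT (hE.mono (le_max_right _ _)) x'
      exact (H (hE.mono (by omega)) (hE'.mono (by omega)) (hx.similar_snoc h2.symm).symm).1 (hf x)
    · intro hf x
      obtain ⟨x', hx⟩ := h2.exists_isExtension hT (hE'.mono (le_max_right _ _)) x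
      exact (H (hE.mono (by omega)) (hE'.mono (by omega)) (hx.similar_snoc h2)).2 (hf x')

/-! ### Generic tuples of independent vertices -/

/-- A tuple of vertices of a split graph is `T`-generic if it consists of independent vertices and
each of its cells has at least `T` elements. -/
structure IsGeneric {A B ι : Type} (T : ℕ) (E : A → B → Prop) (v : ι → A ⊕ B) : Prop where
  isLeft_eq : ∀ i, (v i).isLeft = false
  le_ncard_cell : ∀ ε, T ≤ (cell E v ε).ncard

namespace IsGeneric

variable {A B A' B' ι : Type} {T : ℕ} {E : A → B → Prop} {E' : A' → B' → Prop}
  {v : ι → A ⊕ B} {v' : ι → A' ⊕ B'}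

lemma injective (hT : 1 ≤ T) (h : IsGeneric T E v) : Function.Injective v := by
  intro i j hij
  have h1 := hT.trans (h.le_ncard_cell fun k => k = i)
  obtain ⟨a, ha⟩ := Set.nonempty_of_ncard_ne_zero (by omega : (cell E v fun k => k = i).ncard ≠ 0)
  exact ((ha j).1 (hij ▸ (ha i).2 rfl)).symm

lemma similar (hT : 1 ≤ T) (h : IsGeneric T E v) (h' : IsGeneric T E' v') :
    Similar T E E' v v' where
  isLeft_eq i := by rw [h.isLeft_eq, h'.isLeft_eq]
  eq_iff i j := by rw [(h.injective hT).eq_iff, (h'.injective hT).eq_iff]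
  ncard_cell ε := by rw [min_eq_left (h.le_ncard_cell ε), min_eq_left (h'.le_ncard_cell ε)]

end IsGeneric

/-! ### Random functions on a square hit every set often -/

lemma card_forall_row_notMem {Q : Type} [Fintype Q] [DecidableEq Q] {m : ℕ} {P : Finset Q}
    (hP : P.Nonempty) (t : Fin m) :
    ((Finset.univ.filter fun u : Fin m × Fin m → Q => ∀ k, u (t, k) ∉ P).card : ℝ) ≤
      (1 - 1 / Fintype.card Q) ^ m * Fintype.card (Fin m × Fin m → Q) := by
  have hq : 0 < (Fintype.card Q : ℝ) := by
    exact_mod_cast Fintype.card_pos_iff.2 ⟨hP.choose⟩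
  have h1 : (Finset.univ.filter fun u : Fin m × Fin m → Q => ∀ k, u (t, k) ∉ P) =
      Fintype.piFinset fun a : Fin m × Fin m => if a.1 = t then Pᶜ else Finset.univ := by
    ext u
    simp only [Finset.mem_filter, Finset.mem_univ, true_and, Fintype.mem_piFinset, Prod.forall]
    constructor
    · intro h s k
      split_ifs with hs
      · subst hs
        simpa using h k
      · simp
    · intro h k
      simpa using h t k
  have h2 : ∀ a : Fin m × Fin m, ((if a.1 = t then Pᶜ else Finset.univ : Finset Q).card : ℝ) ≤
      (if a.1 = t then 1 - 1 / (Fintype.card Q : ℝ) else 1) * Fintype.card Q := by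
    intro a
    split_ifs
    · have h3 : 1 ≤ P.card := hP.card_pos
      have h4 : P.card + Pᶜ.card = Fintype.card Q := Finset.card_add_card_compl P
      have h5 : (1 : ℝ) + (Pᶜ.card : ℝ) ≤ Fintype.card Q := by exact_mod_cast (by omega)
      rw [sub_mul, one_mul, one_div, inv_mul_cancel₀ hq.ne']
      linarith
    · simp
  rw [h1, Fintype.card_piFinset, Nat.cast_prod]
  refine (Finset.prod_le_prod (fun _ _ => Nat.cast_nonneg _) fun a _ => h2 a).trans_eq ?_
  rw [Finset.prod_mul_distrib, Fintype.prod_prod_type]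
  simp [Finset.prod_ite_eq']

/-- Given finitely many nonempty subsets `P k` of `Q`, almost every function on an `m × m` square
takes values in each of them at least `m` times: it even does so in every row. -/
lemma card_exists_card_lt {Q κ : Type} [Fintype Q] [DecidableEq Q] [Fintype κ] [DecidableEq κ]
    {m : ℕ} {P : κ → Finset Q} (hP : ∀ k, (P k).Nonempty) :
    ((Finset.univ.filter fun u : Fin m × Fin m → Q =>
        ∃ k, (Finset.univ.filter fun a => u a ∈ P k).card < m).card : ℝ) ≤
      Fintype.card κ * (m * (1 - 1 / Fintype.card Q) ^ m) *
        Fintype.card (Fin m × Fin m → Q) := by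
  have hsub : (Finset.univ.filter fun u : Fin m × Fin m → Q =>
        ∃ k, (Finset.univ.filter fun a => u a ∈ P k).card < m) ⊆
      (Finset.univ : Finset (κ × Fin m)).biUnion fun kt =>
        Finset.univ.filter fun u : Fin m × Fin m → Q => ∀ l, u (kt.2, l) ∉ P kt.1 := by
    intro u hu
    obtain ⟨k, hk⟩ := (Finset.mem_filter.1 hu).2
    simp only [Finset.mem_biUnion, Finset.mem_univ, Finset.mem_filter, true_and, Prod.exists]
    refine ⟨k, ?_⟩
    by_contra! hrow
    choose g hg using hrow
    refine hk.not_ge ?_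
    calc m = (Finset.univ.image fun t : Fin m => (t, g t)).card := by
          rw [Finset.card_image_of_injective _ fun s t h => (Prod.ext_iff.1 h).1]
          simp
      _ ≤ _ := Finset.card_le_card fun a ha => by
          obtain ⟨t, -, rfl⟩ := Finset.mem_image.1 ha
          simpa using hg t
  refine (Nat.cast_le.2 ((Finset.card_le_card hsub).trans Finset.card_biUnion_le)).trans ?_
  rw [Nat.cast_sum]
  refine (Finset.sum_le_sum fun kt _ => card_forall_row_notMem (hP kt.1) kt.2).trans_eq ?_
  rw [Finset.sum_const, Finset.card_univ, Fintype.card_prod, Fintype.card_fin, nsmul_eq_mul]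
  push_cast
  ring

/-! ### The threshold graphs -/

/-- The incidence relation between points `a` and functions `b : A → Fin 5` that holds when `b a`
is one of the first `c` values. A fixed point is incident to a fraction `c / 5` of all functions. -/
def thresholdRel (A : Type) (c : ℕ) (a : A) (b : A → Fin 5) : Prop := (b a).val < c

instance (A : Type) (c : ℕ) (a : A) (b : A → Fin 5) : Decidable (thresholdRel A c a b) :=
  inferInstanceAs (Decidable ((b a).val < c))

lemma isRich_thresholdRel {A : Type} [Fintype A] {c K : ℕ} (hc : 2 ≤ c) (hc' : c ≤ 3)
    (hK : K < 2 ^ Fintype.card A) : IsRich K (thresholdRel A c) := by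
  classical
  intro S F hF
  -- Two values lie below the threshold and two above, so `S` has at least `2 ^ |A|` preimages.
  set f : (A → Bool) → A → Fin 5 := fun g a =>
    if a ∈ S then (if g a then 0 else 1) else (if g a then 3 else 4) with hf
  have hinj : Function.Injective f := by
    intro g g' h
    ext a
    have := congrFun h a
    simp only [hf] at this
    by_cases hS : a ∈ S <;> cases hg : g a <;> cases hg' : g' a <;> simp [hS, hg, hg'] at this ⊢
  obtain ⟨b, hb, hbF⟩ := Finset.exists_mem_notMem_of_card_lt_card
    (s := F) (t := Finset.univ.image f) (by
      rw [Finset.card_image_of_injective _ hinj, Finset.card_univ, Fintype.card_fun,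
        Fintype.card_bool]
      omega)
  obtain ⟨g, -, rfl⟩ := Finset.mem_image.1 hb
  refine ⟨f g, hbF, fun a => ?_⟩
  simp only [thresholdRel, hf]
  by_cases hS : a ∈ S <;> cases hg : g a <;> simp [hS] <;> omega

/-- All but a vanishing fraction of the tuples of independent vertices of a threshold graph are
`m`-generic. -/
lemma le_card_isGeneric {c p m : ℕ} (hc : 2 ≤ c) (hc' : c ≤ 3) :
    (1 - 2 ^ p * (m * (1 - 1 / 5 ^ p) ^ m)) * (5 ^ (m * m)) ^ p ≤
      (Nat.card {v : Fin p → (Fin m × Fin m) ⊕ (Fin m × Fin m → Fin 5) //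
        IsGeneric m (thresholdRel (Fin m × Fin m) c) v} : ℝ) := by
  classical
  set A := Fin m × Fin m
  set P : (Fin p → Prop) → Finset (Fin p → Fin 5) := fun ε =>
    Finset.univ.filter fun x => ∀ i, (x i).val < c ↔ ε i with hPdef
  have hP : ∀ ε, (P ε).Nonempty := fun ε => ⟨fun i => if ε i then 0 else 4, by
    simp only [hPdef, Finset.mem_filter, Finset.mem_univ, true_and]
    intro i
    by_cases hi : ε i <;> simp [hi] <;> omega⟩
  have hbad := card_exists_card_lt (m := m) hP
  set bad := Finset.univ.filter fun u : A → Fin p → Fin 5 =>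
    ∃ ε, (Finset.univ.filter fun a => u a ∈ P ε).card < m with hbaddef
  have hgood : badᶜ.card ≤ Nat.card {v : Fin p → A ⊕ (A → Fin 5) //
      IsGeneric m (thresholdRel A c) v} := by
    have hgen : ∀ u ∈ badᶜ, IsGeneric m (thresholdRel A c)
        fun i => (Sum.inr fun a => u a i : A ⊕ (A → Fin 5)) := by
      intro u hu
      refine ⟨fun _ => rfl, fun ε => ?_⟩
      simp only [hbaddef, Finset.mem_compl, Finset.mem_filter, Finset.mem_univ, true_and,
        not_exists, not_lt] at hu
      refine (hu ε).trans_eq ?_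
      rw [← Set.ncard_coe_finset]
      congr 1
      ext a
      simp [hPdef, cell, trace, thresholdRel]
    rw [← Fintype.card_coe, ← Nat.card_eq_fintype_card]
    refine Nat.card_le_card_of_injective (fun u => ⟨_, hgen u.1 u.2⟩) fun u u' h => ?_
    ext a i
    exact congrArg Fin.val (congrFun (Sum.inr_injective (congrFun (Subtype.ext_iff.1 h) i)) a)
  have hsum : (badᶜ.card : ℝ) + bad.card = Fintype.card (A → Fin p → Fin 5) := by
    exact_mod_cast Finset.card_compl_add_card bad
  have hcard : (Fintype.card (A → Fin p → Fin 5) : ℝ) = (5 ^ (m * m)) ^ p := by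
    simp [A, ← pow_mul, mul_comm]
  have h1 : (badᶜ.card : ℝ) ≤ Nat.card {v : Fin p → A ⊕ (A → Fin 5) //
      IsGeneric m (thresholdRel A c) v} := by exact_mod_cast hgood
  rw [hcard] at hbad hsum
  simp only [Fintype.card_fun, Fintype.card_prop, Fintype.card_fin, Nat.cast_pow,
    Nat.cast_ofNat] at hbad
  linarith

/-! ### Convergence of the Stone pairings -/

lemma stonePairing_le_one {L : Language} {M : Type} [L.Structure M] [Finite M] {p : ℕ}
    (φ : L.Formula (Fin p)) : stonePairing M φ ≤ 1 :=
  div_le_one_of_le₀ (by exact_mod_cast Finite.card_subtype_le _) (Nat.cast_nonneg _)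

lemma le_stonePairing {L : Language} {M : Type} [L.Structure M] [Finite M] {p : ℕ}
    {φ : L.Formula (Fin p)} {g : (Fin p → M) → Prop} (h : ∀ v, g v → φ.Realize v) :
    (Nat.card {v // g v} : ℝ) / Nat.card (Fin p → M) ≤ stonePairing M φ := by
  unfold stonePairing
  gcongr
  exact Nat.card_le_card_of_injective (Subtype.map id h) (Subtype.map_injective h fun _ _ h => h)

lemma stonePairing_le_one_sub {L : Language} {M : Type} [L.Structure M] [Finite M] [Nonempty M]
    {p : ℕ} {φ : L.Formula (Fin p)} {g : (Fin p → M) → Prop} (h : ∀ v, g v → ¬ φ.Realize v) :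
    stonePairing M φ ≤ 1 - (Nat.card {v // g v} : ℝ) / Nat.card (Fin p → M) := by
  classical
  have h1 : Nat.card {v : Fin p → M // φ.Realize v} + Nat.card {v // g v} ≤
      Nat.card (Fin p → M) := by
    rw [← Nat.card_sum]
    refine Nat.card_le_card_of_injective (Sum.elim Subtype.val Subtype.val)
      (Subtype.val_injective.sumElim Subtype.val_injective fun a b hab => ?_)
    exact h b.1 b.2 (hab ▸ a.2)
  have h2 : 0 < (Nat.card (Fin p → M) : ℝ) := by exact_mod_cast Nat.card_pos
  unfold stonePairing
  rw [le_sub_iff_add_le, ← add_div, div_le_one h2]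
  exact_mod_cast h1

/-- The clique of the `n`-th graph of the sequence: an `(n + 1) × (n + 1)` square of vertices. -/
abbrev Square (n : ℕ) : Type := Fin (n + 1) × Fin (n + 1)

/-- The vertices of the `n`-th graph of the sequence. The clique is exponentially smaller than the
independent part. -/
abbrev Vertex (n : ℕ) : Type := Square n ⊕ (Square n → Fin 5)

/-- The threshold of the `n`-th graph of the sequence: it alternates between `2` and `3`. -/
def threshold (n : ℕ) : ℕ := if Even n then 2 else 3

lemma two_le_threshold (n : ℕ) : 2 ≤ threshold n := by
  unfold threshold; split_ifs <;> omega

lemma threshold_le_three (n : ℕ) : threshold n ≤ 3 := by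
  unfold threshold; split_ifs <;> omega

/-- The incidence relation of the `n`-th graph of the sequence. -/
abbrev incidence (n : ℕ) : Square n → (Square n → Fin 5) → Prop :=
  thresholdRel (Square n) (threshold n)

/-- The fraction of independent vertices among the vertices of the `n`-th graph. -/
noncomputable def independentRatio (n : ℕ) : ℝ :=
  5 ^ ((n + 1) * (n + 1)) / Nat.card (Vertex n)

lemma card_vertex (n : ℕ) :
    (Nat.card (Vertex n) : ℝ) = (n + 1) * (n + 1) + 5 ^ ((n + 1) * (n + 1)) := by
  simp [Nat.card_eq_fintype_card]

lemma tendsto_square_div_card_vertex :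
    Tendsto (fun n : ℕ => ((n + 1) * (n + 1) : ℝ) / Nat.card (Vertex n)) atTop (𝓝 0) := by
  have h1 : Tendsto (fun N : ℕ => (N : ℝ) * (1 / 5 : ℝ) ^ N) atTop (𝓝 0) :=
    tendsto_self_mul_const_pow_of_lt_one (by norm_num) (by norm_num)
  have h2 : Tendsto (fun n : ℕ => (n + 1) * (n + 1)) atTop atTop :=
    tendsto_atTop_mono (fun n => by rw [id_eq]; nlinarith) tendsto_id
  refine squeeze_zero (fun n => by positivity) (fun n => ?_) (h1.comp h2)
  rw [Function.comp_apply, card_vertex, one_div_pow, mul_one_div]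
  push_cast
  gcongr
  nlinarith

lemma tendsto_independentRatio : Tendsto independentRatio atTop (𝓝 1) := by
  have h := tendsto_square_div_card_vertex.const_sub 1
  rw [sub_zero] at h
  refine h.congr fun n => ?_
  rw [independentRatio, card_vertex]
  field_simp
  ring

lemma tendsto_card_isGeneric (p : ℕ) :
    Tendsto (fun n => (Nat.card {v : Fin p → Vertex n // IsGeneric (n + 1) (incidence n) v} : ℝ) /
      Nat.card (Fin p → Vertex n)) atTop (𝓝 1) := by
  have hq : |1 - 1 / 5 ^ p| < (1 : ℝ) := by
    have h1 : (1 : ℝ) ≤ 5 ^ p := one_le_pow₀ (by norm_num)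
    have h2 : 0 < 1 / (5 : ℝ) ^ p := by positivity
    have h3 : 1 / (5 : ℝ) ^ p ≤ 1 := by rw [div_le_one (by positivity)]; exact h1
    rw [abs_lt]
    constructor <;> linarith
  have h1 : Tendsto (fun n : ℕ => 1 - 2 ^ p * (((n + 1 : ℕ) : ℝ) * (1 - 1 / 5 ^ p) ^ (n + 1)))
      atTop (𝓝 1) := by
    have h := ((tendsto_self_mul_const_pow_of_abs_lt_one hq).comp (tendsto_add_atTop_nat 1))
    simpa using (h.const_mul (2 ^ p)).const_sub 1
  have h2 := h1.mul (tendsto_independentRatio.pow p)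
  rw [one_pow, mul_one] at h2
  refine tendsto_of_tendsto_of_tendsto_of_le_of_le h2 tendsto_const_nhds (fun n => ?_) fun n => ?_
  · have h3 := le_card_isGeneric (p := p) (m := n + 1) (two_le_threshold n) (threshold_le_three n)
    rw [independentRatio, div_pow, ← mul_div_assoc, Nat.card_fun, Nat.card_fin, Nat.cast_pow]
    gcongr
  · exact div_le_one_of_le₀ (Nat.cast_le.2 (Finite.card_subtype_le _)) (Nat.cast_nonneg _)

/-- Since generic tuples of all sufficiently late graphs give a formula the same truth value, and
almost all tuples are generic, every Stone pairing tends to `0` or `1`. -/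
lemma graphFOConvergent_splitGraph :
    GraphFOConvergent fun n => splitGraph (incidence n) := by
  intro p φ
  let _ := fun n => (splitGraph (incidence n)).structure
  obtain ⟨T, hT, H⟩ := exists_threshold φ
  have hrich : ∀ n, T ≤ n → IsRich T (incidence n) := fun n hn =>
    isRich_thresholdRel (two_le_threshold n) (threshold_le_three n) (by
      refine (Nat.lt_two_pow_self (n := T)).trans_le (Nat.pow_le_pow_right (by omega) ?_)
      rw [Fintype.card_prod, Fintype.card_fin]
      nlinarith)
  have hagree : ∀ n n', T ≤ n → T ≤ n' → ∀ (v : Fin p → Vertex n) (v' : Fin p → Vertex n'),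
      IsGeneric (n + 1) (incidence n) v → IsGeneric (n' + 1) (incidence n') v' →
      (φ.Realize v ↔ φ.Realize v') := by
    intro n n' hn hn' v v' hv hv'
    have hs : ∀ {k : ℕ} {w : Fin p → Vertex k}, T ≤ k → IsGeneric (k + 1) (incidence k) w →
        ∀ xs : Fin 0 → Vertex k, IsGeneric T (incidence k) (Sum.elim w xs) := by
      intro k w hk hw xs
      refine ⟨by simpa [Sum.forall] using hw.isLeft_eq, fun ε => ?_⟩
      refine (hk.trans k.le_succ).trans ((hw.le_ncard_cell fun i => ε (.inl i)).trans_eq ?_)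
      congr 1
      ext a
      simp [cell, Sum.forall]
    exact H (hrich n hn) (hrich n' hn') ((hs hn hv _).similar hT (hs hn' hv' _))
  have hlim := tendsto_card_isGeneric p
  by_cases h : ∃ n, T ≤ n ∧ ∃ v : Fin p → Vertex n, IsGeneric (n + 1) (incidence n) v ∧ φ.Realize v
  · obtain ⟨n₀, hn₀, v₀, hv₀, hφ⟩ := h
    refine ⟨1, tendsto_of_tendsto_of_tendsto_of_le_of_le' hlim tendsto_const_nhds ?_
      (Eventually.of_forall fun n => stonePairing_le_one φ)⟩
    filter_upwards [eventually_ge_atTop T] with n hn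
    exact le_stonePairing fun v hv => (hagree n n₀ hn hn₀ v v₀ hv hv₀).2 hφ
  · push Not at h
    have hlim' := hlim.const_sub 1
    rw [sub_self] at hlim'
    refine ⟨0, tendsto_of_tendsto_of_tendsto_of_le_of_le' tendsto_const_nhds hlim'
      (Eventually.of_forall fun n => by unfold stonePairing; positivity) ?_⟩
    filter_upwards [eventually_ge_atTop T] with n hn
    exact stonePairing_le_one_sub fun v hv => h n hn v hv

/-! ### The formula defining the clique -/

/-- The formula `ξ(x)` saying that `x` has two distinct nonadjacent neighbours. -/
def cliqueFormula : Language.graph.Formula (Fin 1) :=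
  ((adj.boundedFormula₂ (Term.var (Sum.inl 0)) (Term.var (Sum.inr 0)) ⊓
    adj.boundedFormula₂ (Term.var (Sum.inl 0)) (Term.var (Sum.inr 1))) ⊓
    (∼(Term.bdEqual (Term.var (Sum.inr 0)) (Term.var (Sum.inr 1))) ⊓
    ∼(adj.boundedFormula₂ (Term.var (Sum.inr 0)) (Term.var (Sum.inr 1))) :
      Language.graph.BoundedFormula (Fin 1) 2)).ex.ex

lemma mem_solutions_cliqueFormula {V : Type} {G : SimpleGraph V} {x : V} :
    x ∈ solutions G cliqueFormula ↔
      ∃ y z, (G.Adj x y ∧ G.Adj x z) ∧ y ≠ z ∧ ¬ G.Adj y z := by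
  let _ := G.structure
  have h : ∀ a b : V, Structure.RelMap adj ![a, b] ↔ G.Adj a b := fun a b => Iff.rfl
  simp [solutions, cliqueFormula, Formula.Realize, h, Fin.snoc]

lemma isLeft_of_mem_solutions {A B : Type} {E : A → B → Prop} {x : A ⊕ B}
    (hx : x ∈ solutions (splitGraph E) cliqueFormula) : ∃ a, x = Sum.inl a := by
  obtain ⟨y, z, ⟨hy, hz⟩, hne, hyz⟩ := mem_solutions_cliqueFormula.1 hx
  rcases x with a | b
  · exact ⟨a, rfl⟩
  · rcases y with y | y <;> rcases z with z | z <;> simp_all [splitGraph]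

lemma solutions_nonempty (n : ℕ) :
    (solutions (splitGraph (incidence n)) cliqueFormula).Nonempty := by
  have h := two_le_threshold n
  refine ⟨Sum.inl 0, mem_solutions_cliqueFormula.2
    ⟨Sum.inr fun _ => 0, Sum.inr fun _ => 1, ⟨?_, ?_⟩, ?_, ?_⟩⟩
  · change 0 < threshold n
    omega
  · change 1 < threshold n
    omega
  · intro h
    exact absurd (congrFun (Sum.inr_injective h) 0) (by decide)
  · exact id

/-! ### The degrees of the roots -/

/-- The formula saying that `x` is adjacent to the root. -/
def adjRootFormula : rootedGraphLanguage.Formula (Fin 1) :=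
  Relations.formula₂ ((Language.graph.lhomWithConstants Unit).onRelation adj) (Term.var 0)
    (Constants.term (Language.graph.con ()))

lemma stonePairing_adjRootFormula {V : Type} [Finite V] (G : SimpleGraph V) (r : V) :
    @stonePairing _ V (rootedStructure G r) _ _ adjRootFormula =
      (Nat.card {x // G.Adj x r} : ℝ) / Nat.card V := by
  let _ := rootedStructure G r
  have h : ∀ v : Fin 1 → V, adjRootFormula.Realize v ↔ G.Adj (v 0) r := fun v => by
    rw [adjRootFormula, Formula.realize_rel₂]
    rfl
  unfold stonePairing
  congr 2
  · exact Nat.card_congr ((Equiv.funUnique (Fin 1) V).subtypeEquiv h)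
  · exact Nat.card_congr (Equiv.funUnique (Fin 1) V)

lemma card_thresholdRel {A : Type} [Fintype A] {c : ℕ} (hc : c ≤ 5) (a : A) :
    (Nat.card {b : A → Fin 5 // thresholdRel A c a b} : ℝ) = c / 5 * 5 ^ Fintype.card A := by
  classical
  have h1 : (Finset.univ.filter fun b : A → Fin 5 => thresholdRel A c a b) =
      Fintype.piFinset fun a' => if a' = a then Finset.univ.filter (fun k : Fin 5 => k.val < c)
        else Finset.univ := by
    ext b
    rw [Finset.mem_filter_univ, Fintype.mem_piFinset]
    change (b a).val < c ↔ _
    constructor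
    · intro h a'
      split_ifs with ha
      · simpa [ha] using h
      · simp
    · intro h
      simpa using h a
  have h2 : ∀ a', ((if a' = a then Finset.univ.filter (fun k : Fin 5 => k.val < c)
      else Finset.univ : Finset (Fin 5)).card : ℝ) = (if a' = a then (c / 5 : ℝ) else 1) * 5 := by
    intro a'
    split_ifs
    · rw [Fin.card_filter_val_lt, min_eq_right hc]
      ring
    · simp
  rw [Nat.card_eq_fintype_card, Fintype.card_subtype, h1, Fintype.card_piFinset, Nat.cast_prod,
    Finset.prod_congr rfl fun a' _ => h2 a', Finset.prod_mul_distrib]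
  simp

lemma card_adj_inl (n : ℕ) (a : Square n) :
    (Nat.card {x // (splitGraph (incidence n)).Adj x (Sum.inl a)} : ℝ) =
      Nat.card {a' : Square n // a' ≠ a} + threshold n / 5 * 5 ^ ((n + 1) * (n + 1)) := by
  have h := card_thresholdRel (A := Square n) (c := threshold n)
    ((threshold_le_three n).trans (by omega)) a
  rw [Fintype.card_prod, Fintype.card_fin] at h
  rw [Nat.card_congr Equiv.subtypeSum, Nat.card_sum, Nat.cast_add, ← h]
  rfl

/-- The roots have degree densities close to `2 / 5` for even `n` and to `3 / 5` for odd `n`. -/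
lemma tendsto_stonePairing_adjRootFormula {r : ∀ n, Vertex n}
    (hr : ∀ n, r n ∈ solutions (splitGraph (incidence n)) cliqueFormula) :
    Tendsto (fun n => @stonePairing _ (Vertex n) (rootedStructure (splitGraph (incidence n)) (r n))
      _ _ adjRootFormula - threshold n / 5 * independentRatio n) atTop (𝓝 0) := by
  refine squeeze_zero (fun n => ?_) (fun n => ?_) tendsto_square_div_card_vertex
  all_goals
    obtain ⟨a, ha⟩ := isLeft_of_mem_solutions (hr n)
    rw [stonePairing_adjRootFormula, ha, card_adj_inl, independentRatio, add_div, ← mul_div_assoc,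
      add_sub_cancel_right]
  · positivity
  · gcongr
    have h := Finite.card_subtype_le fun a' : Square n => a' ≠ a
    simp only [Nat.card_prod, Nat.card_fin] at h
    exact_mod_cast h

lemma not_rootedGraphFOConvergent {r : ∀ n, Vertex n}
    (hr : ∀ n, r n ∈ solutions (splitGraph (incidence n)) cliqueFormula) :
    ¬ RootedGraphFOConvergent (fun n => splitGraph (incidence n)) r := by
  intro h
  obtain ⟨a, ha⟩ := h 1 adjRootFormula
  have h1 := ha.sub (tendsto_stonePairing_adjRootFormula hr)
  simp only [sub_sub_cancel, sub_zero] at h1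
  have h2 : Tendsto (fun n => (threshold n / 5 : ℝ)) atTop (𝓝 a) := by
    have h3 := h1.div tendsto_independentRatio one_ne_zero
    rw [div_one] at h3
    refine h3.congr fun n => ?_
    have h4 : independentRatio n ≠ 0 := by
      rw [independentRatio, card_vertex]
      positivity
    simp [h4]
  have heven : Tendsto (fun n : ℕ => 2 * n) atTop atTop :=
    tendsto_atTop_mono (fun n => by rw [id_eq]; omega) tendsto_id
  have hodd : Tendsto (fun n : ℕ => 2 * n + 1) atTop atTop :=
    tendsto_atTop_mono (fun n => by rw [id_eq]; omega) tendsto_id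
  have h5 := h2.comp heven
  have h6 := h2.comp hodd
  simp only [Function.comp_def, threshold, even_two_mul, if_true, Nat.not_even_bit1,
    if_false, Nat.cast_ofNat] at h5 h6
  have h7 := tendsto_nhds_unique h5 tendsto_const_nhds
  have h8 := tendsto_nhds_unique h6 tendsto_const_nhds
  linarith

end StructuralConvergence

theorem mainTheorem4 :
    ∃ (V : ℕ → Type) (_ : ∀ n, Finite (V n)) (G : ∀ n, SimpleGraph (V n))
      (ξ : FirstOrder.Language.graph.Formula (Fin 1)),
      StructuralConvergence.GraphFOConvergent G ∧
      (∀ n, (StructuralConvergence.solutions (G n) ξ).Nonempty) ∧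
      ¬ ∃ r : ∀ n, V n,
        (∀ n, r n ∈ StructuralConvergence.solutions (G n) ξ) ∧
        StructuralConvergence.RootedGraphFOConvergent G r :=
  ⟨StructuralConvergence.Vertex, inferInstance,
    fun n => StructuralConvergence.splitGraph (StructuralConvergence.incidence n),
    StructuralConvergence.cliqueFormula, StructuralConvergence.graphFOConvergent_splitGraph,
    StructuralConvergence.solutions_nonempty,
    fun ⟨_, hr, hconv⟩ => StructuralConvergence.not_rootedGraphFOConvergent hr hconv⟩
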